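/- Let $n\ge 2$, let $p>n$ be real, let $\mathbb B^n=\{x\in\mathbb R^n:|x|<1\}$ and let $Q:\mathbb B^n\to[0,\infty]$ be Lebesgue measurable. For a family $\Gamma$ of curves in $\mathbb R^n$, let $M_p(\Gamma)=\inf_\rho\int_{\mathbb R^n}\rho^p\,dm$, where $\rho$ runs over all Borel functions $\rho:\mathbb R^n\to[0,\infty]$ with $\int_\gamma\rho\,ds\ge 1$ for every locally rectifiable $\gamma\in\Gamma$. Let $\Delta(E,F,G)$ be the set of all continuous curves $\gamma:[a,b]\to\mathbb R^n$ with $\gamma(a)\in E$, $\gamma(b)\in F$ and $\gamma(t)\in G$ for $a<t<b$, and let $S_r=\{x\in\mathbb R^n:|x|=r\}$. Let $f:\mathbb B^n\to\mathbb R^n$ be a homeomorphism onto its image with $f(0)=0$ that is a ring $Q$-homeomorphism with respect to $p$-modulus at $0$, that is, $$M_p\big(\Delta(f(S_{r_1}),f(S_{r_2}),f(\mathbb B^n))\big)\le\int_{\{r_1<|x|<r_2\}}Q(x)\,\eta^p(|x|)\,dm(x)$$ for all $0<r_1<r_2<1$ and all measurable $\eta:(r_1,r_2)\to[0,\infty]$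 with $\int_{r_1}^{r_2}\eta(r)\,dr=1$. If $K\in(0,\infty)$ and $Q(x)\le K$ for almost every $x\in\mathbb B^n$, then $$\limsup_{x\to0}\frac{|f(x)|}{|x|}\ \ge\ K^{\frac1{n-p}}.$$ -/

import Mathlib

open Set Filter Topology MeasureTheory
open scoped ENNReal

noncomputable section

/-- A continuous curve `γ : [a, b] → ℝⁿ`. Only the values of `toFun` on `[a, b]` matter. -/
structure ClosedCurve (n : ℕ) where
  a : ℝ
  b : ℝ
  lt : a < b
  toFun : ℝ → EuclideanSpace ℝ (Fin n)
  continuousOn : ContinuousOn toFun (Icc a b)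

/-- Local rectifiability; on a compact interval this is the same as finite length. -/
def ClosedCurve.LocallyRectifiable {n : ℕ} (γ : ClosedCurve n) : Prop :=
  LocallyBoundedVariationOn γ.toFun (Icc γ.a γ.b)

/-- The length of a curve: the supremum of the lengths of inscribed polygons. -/
def ClosedCurve.length {n : ℕ} (γ : ClosedCurve n) : ℝ≥0∞ :=
  eVariationOn γ.toFun (Icc γ.a γ.b)

/-- The integral `∫_γ ρ ds` with respect to arc length, for a rectifiable curve `γ`: the integral
over `[0, length γ]` of `ρ` along the arc length parametrization of `γ`. -/
def ClosedCurve.lineIntegral {n : ℕ} (γ : ClosedCurve n)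
    (ρ : EuclideanSpace ℝ (Fin n) → ℝ≥0∞) : ℝ≥0∞ :=
  ∫⁻ s in Icc (0 : ℝ) γ.length.toReal,
    ρ (naturalParameterization γ.toFun (Icc γ.a γ.b) γ.a s)

/-- A Borel function `ρ : ℝⁿ → [0, ∞]` is admissible for the curve family `Γ` if
`∫_γ ρ ds ≥ 1` for all locally rectifiable `γ ∈ Γ`. -/
def IsAdmissible {n : ℕ} (Γ : Set (ClosedCurve n))
    (ρ : EuclideanSpace ℝ (Fin n) → ℝ≥0∞) : Prop :=
  Measurable ρ ∧ ∀ γ ∈ Γ, γ.LocallyRectifiable → 1 ≤ γ.lineIntegral ρ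

/-- The `p`-modulus of a curve family. -/
def pModulus {n : ℕ} (p : ℝ) (Γ : Set (ClosedCurve n)) : ℝ≥0∞ :=
  ⨅ (ρ : EuclideanSpace ℝ (Fin n) → ℝ≥0∞) (_ : IsAdmissible Γ ρ), ∫⁻ x, ρ x ^ p

/-- `Δ(E, F, G)`: the continuous curves that connect `E` and `F` in `G`. -/
def connectingCurves {n : ℕ} (E F G : Set (EuclideanSpace ℝ (Fin n))) :
    Set (ClosedCurve n) :=
  {γ | γ.toFun γ.a ∈ E ∧ γ.toFun γ.b ∈ F ∧ ∀ t ∈ Ioo γ.a γ.b, γ.toFun t ∈ G}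

/-- The spherical ring `{x : r₁ < |x - x₀| < r₂}`. -/
def sphericalRing {n : ℕ} (x₀ : EuclideanSpace ℝ (Fin n)) (r₁ r₂ : ℝ) :
    Set (EuclideanSpace ℝ (Fin n)) :=
  {x | r₁ < dist x x₀ ∧ dist x x₀ < r₂}

/-- `f : D → ℝⁿ` is a ring `Q`-homeomorphism with respect to `p`-modulus at `x₀ ∈ D`.
Only the values of `f` and `Q` on the domain `D` matter; `f` is a homeomorphism of `D`
onto its image. The distance from `x₀` to the boundary of `D` is `∞` if the boundary is empty. -/
structure IsRingQHomeomorphismAt {n : ℕ} (p : ℝ) (D : Set (EuclideanSpace ℝ (Fin n)))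
    (Q : EuclideanSpace ℝ (Fin n) → ℝ≥0∞)
    (f : EuclideanSpace ℝ (Fin n) → EuclideanSpace ℝ (Fin n))
    (x₀ : EuclideanSpace ℝ (Fin n)) : Prop where
  isOpen : IsOpen D
  isConnected : IsConnected D
  mem : x₀ ∈ D
  /-- `Q` is Lebesgue measurable on `D`. -/
  aemeasurable : AEMeasurable Q (volume.restrict D)
  isEmbedding : IsEmbedding (fun x : D => f x)
  modulus_le : ∀ r₁ r₂ : ℝ, 0 < r₁ → r₁ < r₂ →
    ENNReal.ofReal r₂ < Metric.infEDist x₀ (frontier D) →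
    ∀ η : ℝ → ℝ≥0∞, AEMeasurable η (volume.restrict (Ioo r₁ r₂)) →
      ∫⁻ r in Ioo r₁ r₂, η r = 1 →
      pModulus p (connectingCurves (f '' Metric.sphere x₀ r₁) (f '' Metric.sphere x₀ r₂) (f '' D))
        ≤ ∫⁻ x in sphericalRing x₀ r₁ r₂, Q x * η (dist x x₀) ^ p

end

/-! Fix `r < 1` and let `L` be the maximum of `‖f‖` on the sphere of radius `r`. The modulus of the
curves joining the images of the spheres of radii `r₁ < r` is estimated from both sides. Put `α = (p
- n) / (p - 1)`, and let `ω` be the area of the unit sphere. From below (`le_pModulus_of_radial`):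
every ray from 0 carries a segment of the family inside the ball of radius `L`
(`exists_radial_segment`). Hölder's inequality on each ray and polar coordinates give at least `ω (L
^ α / α) ^ (1 - p)`. Since `p > n`, `α` is positive and `t ^ (α - 1)` is integrable at 0, so the
bound does not depend on where the segment starts. From above: the ring inequality with the density
proportional to `t ^ (α - 1)` (`exists_radial_density`) gives at most `K ω ((r ^ α - r₁ ^ α) / α) ^
(1 - p)`. As `r₁ → 0` this becomes `r ^ (p - n) ≤ K L ^ (p - n)`, so the required ratio is attained
on every sphere. The segments exist because `f` maps open balls to open sets. This invariance of
domain is derived from the absence of a `C¹` retraction onto the sphere. -/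

/-! ### Brouwer-type theorems: retractions and zeros of perturbations of the identity -/

open Metric Polynomial in
/-- `t ↦ det (1 + t A)` is polynomial, hence determined by its values at `finrank + 1` nodes. -/
theorem ContinuousLinearMap.det_one_add_smul_eq_sum_lagrange {E : Type*} [NormedAddCommGroup E]
    [InnerProductSpace ℝ E] [FiniteDimensional ℝ E] (A : E →L[ℝ] E)
    (v : ℕ → ℝ) (hv : Function.Injective v) (t : ℝ) :
    (1 + t • A).det = ∑ i ∈ Finset.range (Module.finrank ℝ E + 1),
      (1 + v i • A).det * (Lagrange.basis (Finset.range (Module.finrank ℝ E + 1)) v i).eval t := by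
  set b := Module.finBasis ℝ E
  set M := LinearMap.toMatrix b b (A : E →ₗ[ℝ] E) with hM
  set P : ℝ[X] := Matrix.det ((X : ℝ[X]) • M.map C + (1 : Matrix _ _ ℝ).map C) with hP
  have hPe : ∀ s : ℝ, P.eval s = (1 + s • A).det := by
    intro s
    rw [hP, ← coe_evalRingHom, RingHom.map_det, ContinuousLinearMap.det,
      ← LinearMap.det_toMatrix b]
    congr 1
    ext i j
    simp [hM, Matrix.one_apply, LinearMap.toMatrix_apply, Module.End.one_apply,
      Finsupp.single_apply, eq_comm, add_comm]
    split_ifs <;> simp [mul_comm]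
  have hdeg : P.degree < (Finset.range (Module.finrank ℝ E + 1)).card := by
    rw [Finset.card_range]
    refine lt_of_le_of_lt degree_le_natDegree ?_
    have := natDegree_det_X_add_C_le M 1
    rw [Fintype.card_fin] at this
    exact_mod_cast Nat.lt_succ_of_le this
  have := Lagrange.eq_interpolate (hv.injOn) hdeg
  rw [← hPe t, this, Lagrange.interpolate_apply, eval_finsetSum]
  simp [hPe]

open Polynomial in
theorem Lagrange.sum_eval_basis_eq_one (m : ℕ) (v : ℕ → ℝ) (hv : Function.Injective v) (t : ℝ) :
    ∑ i ∈ Finset.range (m + 1), (Lagrange.basis (Finset.range (m + 1)) v i).eval t = 1 := by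
  rw [← eval_finsetSum, Lagrange.sum_basis hv.injOn (by simp), eval_one]

open Metric in
/-- A function that is Lipschitz on the closed unit ball and vanishes on the unit sphere, extended
by zero, is Lipschitz. -/
theorem LipschitzOnWith.extend_zero {E : Type*} [NormedAddCommGroup E] [NormedSpace ℝ E]
    {g : E → E} {L : NNReal} (hL : LipschitzOnWith L g (closedBall 0 1))
    (h0 : ∀ x, 1 ≤ ‖x‖ → g x = 0) : LipschitzWith L g := by
  have key : ∀ x y, ‖x‖ ≤ 1 → 1 < ‖y‖ → dist (g x) (g y) ≤ L * dist x y := by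
    intro x y hx hy
    have hc : ContinuousOn (fun s : ℝ => ‖x + s • (y - x)‖) (Icc 0 1) := by fun_prop
    -- Replace `y` by the point `z` where the segment from `x` to `y` crosses the unit sphere: `g`
    -- vanishes at both, and `z` is no farther from `x`.
    obtain ⟨s, hs, hs1⟩ := intermediate_value_Icc zero_le_one hc
      (show (1 : ℝ) ∈ Icc _ _ by simp [hx, hy.le])
    set z := x + s • (y - x) with hz
    have h1 : g y = g z := by rw [h0 y hy.le, h0 z hs1.ge]
    rw [h1]
    refine (hL.dist_le_mul x (by simpa using hx) z (by simpa using hs1.le)).trans ?_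
    gcongr
    rw [dist_eq_norm, dist_eq_norm, hz, sub_add_cancel_left, norm_neg, norm_smul,
      Real.norm_of_nonneg hs.1, norm_sub_rev]
    exact mul_le_of_le_one_left (norm_nonneg _) hs.2
  refine LipschitzWith.of_dist_le_mul fun x y => ?_
  rcases le_or_gt ‖x‖ 1 with hx | hx <;> rcases le_or_gt ‖y‖ 1 with hy | hy
  · exact hL.dist_le_mul x (by simpa using hx) y (by simpa using hy)
  · exact key x y hx hy
  · rw [dist_comm, dist_comm x]; exact key y x hy hx
  · rw [h0 x hx.le, h0 y hy.le, dist_self]; positivity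

open Metric in
/-- A small Lipschitz perturbation of the identity, supported in the closed unit ball, is a bijection
of the open unit ball. -/
theorem bijOn_ball_id_add_smul {E : Type*} [NormedAddCommGroup E] [NormedSpace ℝ E]
    [CompleteSpace E] [Nontrivial E]
    {g : E → E} {L : NNReal} (hL : LipschitzWith L g)
    (h0 : ∀ x, 1 ≤ ‖x‖ → g x = 0) {t : ℝ} (ht : 0 ≤ t) (htL : t * L < 1) :
    BijOn (fun x => x + t • g x) (ball 0 1) (ball 0 1) := by
  have hA : ApproximatesLinearOn (fun x => x + t • g x)
      ((ContinuousLinearEquiv.refl ℝ E : E ≃L[ℝ] E) : E →L[ℝ] E) univ (t.toNNReal * L) := by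
    rw [ApproximatesLinearOn.approximatesLinearOn_iff_lipschitzOnWith]
    refine LipschitzOnWith.of_dist_le_mul fun x _ y _ => ?_
    have := hL.dist_le_mul x y
    simp only [Pi.sub_apply, ContinuousLinearEquiv.coe_coe, ContinuousLinearEquiv.coe_refl', id,
      add_sub_cancel_left, NNReal.coe_mul, Real.coe_toNNReal t ht]
    rw [dist_smul₀, Real.norm_of_nonneg ht, mul_assoc]
    gcongr
  have hc : Subsingleton E ∨ t.toNNReal * L <
      ‖((ContinuousLinearEquiv.refl ℝ E).symm : E →L[ℝ] E)‖₊⁻¹ := by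
    right
    have : ‖((ContinuousLinearEquiv.refl ℝ E).symm : E →L[ℝ] E)‖₊ = 1 := by
      ext
      simp
    rw [this, inv_one, ← NNReal.coe_lt_coe]
    simpa [Real.coe_toNNReal t ht] using htL
  have hinj := injOn_univ.1 (injOn_iff_injective.2 (hA.injective hc))
  have hsurj := hA.surjective hc
  have hfix : ∀ x, 1 ≤ ‖x‖ → x + t • g x = x := fun x hx => by simp [h0 x hx]
  refine ⟨fun x hx => ?_, hinj.injOn, fun y hy => ?_⟩
  -- Points outside the open ball are fixed. An interior point sent there would have the same image
  -- as its own image, contradicting injectivity.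
  · by_contra h
    have h1 : 1 ≤ ‖x + t • g x‖ := by simpa using h
    have : x + t • g x = x := hinj (hfix _ h1)
    rw [this] at h1
    rw [mem_ball_zero_iff] at hx
    linarith
  · obtain ⟨x, rfl⟩ := hsurj y
    refine ⟨x, ?_, rfl⟩
    by_contra h
    have h1 : 1 ≤ ‖x‖ := by simpa using h
    simp only [hfix x h1] at hy
    exact h hy

open Metric in
/-- There is no `C¹` retraction of the closed unit ball to the unit sphere. -/
theorem not_exists_contDiff_retraction_sphere {E : Type*} [NormedAddCommGroup E]
    [InnerProductSpace ℝ E] [FiniteDimensional ℝ E] [Nontrivial E] (F : E → E)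
    (hF : ∀ x ∈ closedBall (0 : E) 1, ContDiffAt ℝ 1 F x)
    (hid : ∀ x, ‖x‖ = 1 → F x = x) (h1 : ∀ x ∈ closedBall (0 : E) 1, ‖F x‖ = 1) : False := by
  borelize E
  set μ : Measure E := volume
  have hK : IsCompact (closedBall (0 : E) 1) := isCompact_closedBall 0 1
  -- The homotopy `x + t (F x - x)` has derivative `1 + t A x`. The integral of its determinant is a
  -- polynomial in `t`, equal to the volume of the ball for small `t ≥ 0` but to 0 at `t = 1`.
  set A : E → E →L[ℝ] E := fun x => fderiv ℝ F x - 1 with hAdef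
  have hAc : ContinuousOn A (closedBall 0 1) := by
    refine ContinuousOn.sub (fun x hx => ?_) continuousOn_const
    exact ((hF x hx).fderiv_right (m := 0) (by norm_num)).continuousAt.continuousWithinAt
  obtain ⟨C, hC⟩ := hK.exists_bound_of_continuousOn hAc
  have hloc : LocallyLipschitzOn (closedBall (0 : E) 1) (fun x => F x - x) := by
    intro x hx
    obtain ⟨K, t, ht, hKt⟩ := ((hF x hx).sub contDiffAt_id).exists_lipschitzOnWith
    exact ⟨K, t, mem_nhdsWithin_of_mem_nhds ht, hKt⟩
  obtain ⟨L, hL⟩ := hloc.exists_lipschitzOnWith_of_compact hK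
  set g : E → E := fun x => if ‖x‖ < 1 then F x - x else 0 with hg
  have hg0 : ∀ x, 1 ≤ ‖x‖ → g x = 0 := fun x hx => by simp [hg, hx]
  have hgF : EqOn g (fun x => F x - x) (closedBall 0 1) := by
    intro x hx
    rcases lt_or_eq_of_le (mem_closedBall_zero_iff.1 hx) with h | h
    · simp [hg, h]
    · simp [hg, h, hid x h]
  have hgL : LipschitzWith L g :=
    LipschitzOnWith.extend_zero (fun x hx y hy => by rw [hgF hx, hgF hy]; exact hL hx hy) hg0
  have hdet1 : ∀ᶠ B in 𝓝 (1 : E →L[ℝ] E), 0 < B.det := by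
    have : ContinuousAt (fun B : E →L[ℝ] E => B.det) 1 :=
      ContinuousLinearMap.continuous_det.continuousAt
    refine this.eventually (lt_mem_nhds ?_)
    simp [ContinuousLinearMap.det]
  obtain ⟨δ, hδ, hδdet⟩ := Metric.eventually_nhds_iff.1 hdet1
  -- The first smallness condition makes the homotopy a bijection of the ball, the second keeps its
  -- Jacobian positive.
  obtain ⟨τ, hτ, hτL, hτC⟩ : ∃ τ : ℝ, 0 < τ ∧ τ * L < 1 ∧ τ * C < δ := by
    have h : ∀ᶠ τ : ℝ in 𝓝[>] 0, τ * L < 1 ∧ τ * C < δ := by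
      refine nhdsWithin_le_nhds (Filter.Eventually.and ?_ ?_)
      · exact (continuous_mul_const (L : ℝ)).continuousAt.eventually (gt_mem_nhds (by simp))
      · exact (continuous_mul_const C).continuousAt.eventually (gt_mem_nhds (by simpa))
    obtain ⟨τ, h, hτ⟩ := (h.and self_mem_nhdsWithin).exists
    exact ⟨τ, hτ, h.1, h.2⟩
  have hdc : ∀ t : ℝ, ContinuousOn (fun x => (1 + t • A x).det) (closedBall 0 1) := fun t =>
    ContinuousLinearMap.continuous_det.comp_continuousOn (continuousOn_const.add (hAc.const_smul t))
  have hint : ∀ t : ℝ, IntegrableOn (fun x => (1 + t • A x).det) (ball 0 1) μ := fun t =>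
    ((hdc t).integrableOn_compact hK).mono_set ball_subset_closedBall
  have hvol : ∀ t : ℝ, 0 ≤ t → t ≤ τ → ∫ x in ball (0 : E) 1, (1 + t • A x).det ∂μ =
      μ.real (ball 0 1) := by
    intro t ht htτ
    have hb := bijOn_ball_id_add_smul hgL hg0 ht
      (lt_of_le_of_lt (mul_le_mul_of_nonneg_right htτ L.2) hτL)
    have hd : ∀ x ∈ ball (0 : E) 1, HasFDerivWithinAt (fun x => x + t • g x) (1 + t • A x)
        (ball 0 1) x := by
      intro x hx
      have h2 : HasFDerivAt F (fderiv ℝ F x) x :=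
        ((hF x (ball_subset_closedBall hx)).differentiableAt (by norm_num)).hasFDerivAt
      have h3 : HasFDerivAt (fun x => x + t • (F x - x)) (1 + t • A x) x :=
        (hasFDerivAt_id x).add ((h2.sub (hasFDerivAt_id x)).const_smul t)
      refine h3.hasFDerivWithinAt.congr' (fun y hy => ?_) hx
      rw [hgF (ball_subset_closedBall hy)]
    have hpos : ∀ x ∈ ball (0 : E) 1, 0 < (1 + t • A x).det := by
      intro x hx
      refine hδdet ?_
      rw [dist_eq_norm, add_sub_cancel_left, norm_smul, Real.norm_of_nonneg ht]
      have hCx := hC x (ball_subset_closedBall hx)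
      calc t * ‖A x‖ ≤ τ * C := by gcongr
        _ < δ := hτC
    have := lintegral_abs_det_fderiv_eq_addHaar_image μ measurableSet_ball hd hb.injOn
    rw [hb.image_eq] at this
    rw [Measure.real, ← this, integral_eq_lintegral_of_nonneg_ae]
    · congr 1
      refine setLIntegral_congr_fun measurableSet_ball fun x hx => ?_
      simp only [abs_of_pos (hpos x hx)]
    · exact (ae_restrict_iff' measurableSet_ball).2 (.of_forall fun x hx => (hpos x hx).le)
    · exact (hint t).aestronglyMeasurable
  -- Differentiating `‖F‖² = 1` shows that the range of the derivative is orthogonal to `F x ≠ 0`,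
  -- so the derivative is not onto.
  have hzero : ∀ x ∈ ball (0 : E) 1, (1 + (1 : ℝ) • A x).det = 0 := by
    intro x hx
    by_contra hne
    have hA1 : 1 + (1 : ℝ) • A x = fderiv ℝ F x := by simp [hAdef]
    rw [hA1] at hne
    have h2 : HasFDerivAt F (fderiv ℝ F x) x :=
      ((hF x (ball_subset_closedBall hx)).differentiableAt (by norm_num)).hasFDerivAt
    have hin := h2.inner ℝ h2
    have hconst : (fun y => inner ℝ (F y) (F y)) =ᶠ[𝓝 x] fun _ => (1 : ℝ) := by
      filter_upwards [isOpen_ball.mem_nhds hx] with y hy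
      rw [real_inner_self_eq_norm_sq, h1 y (ball_subset_closedBall hy), one_pow]
    have h0 := hin.unique ((hasFDerivAt_const (1 : ℝ) x).congr_of_eventuallyEq hconst)
    obtain ⟨v, hv⟩ : ∃ v, fderiv ℝ F x v = F x := by
      exact (LinearMap.equivOfDetNeZero (fderiv ℝ F x : E →ₗ[ℝ] E) hne).surjective (F x)
    have := congrArg (fun T => T v) h0
    simp [fderivInnerCLM_apply, hv, h1 x (ball_subset_closedBall hx)] at this
  set m := Module.finrank ℝ E
  -- Distinct interpolation nodes in `(0, τ]`, where the integral is already known.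
  set v : ℕ → ℝ := fun i => τ / (i + 1) with hvdef
  have hv : Function.Injective v := by
    intro i j hij
    simp only [hvdef] at hij
    rw [div_eq_div_iff (by positivity) (by positivity)] at hij
    have := mul_left_cancel₀ hτ.ne' hij
    exact_mod_cast (add_right_cancel this).symm
  have hv0 : ∀ i, 0 ≤ v i ∧ v i ≤ τ := fun i =>
    ⟨by positivity, div_le_self hτ.le (by simp)⟩
  have hI : ∫ x in ball (0 : E) 1, (1 + (1 : ℝ) • A x).det ∂μ = μ.real (ball 0 1) := by
    calc _ = ∫ x in ball (0 : E) 1, ∑ i ∈ Finset.range (m + 1),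
          (1 + v i • A x).det * (Lagrange.basis (Finset.range (m + 1)) v i).eval 1 ∂μ := by
          simp only [(A _).det_one_add_smul_eq_sum_lagrange v hv 1, m]
      _ = ∑ i ∈ Finset.range (m + 1),
          μ.real (ball 0 1) * (Lagrange.basis (Finset.range (m + 1)) v i).eval 1 := by
          rw [integral_finsetSum _ fun i _ => (hint (v i)).mul_const _]
          refine Finset.sum_congr rfl fun i _ => ?_
          rw [integral_mul_const, hvol _ (hv0 i).1 (hv0 i).2]
      _ = _ := by rw [← Finset.mul_sum, Lagrange.sum_eval_basis_eq_one m v hv, mul_one]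
  rw [setIntegral_congr_fun measurableSet_ball hzero, integral_zero] at hI
  have : 0 < μ.real (ball (0 : E) 1) :=
    ENNReal.toReal_pos (measure_ball_pos _ _ one_pos).ne' measure_ball_lt_top.ne
  exact this.ne hI

-- If `φ` had no zero, moving from `x` in the direction `φ x` until the unit sphere is hit would be
-- a `C¹` retraction. The hypothesis forces `⟪x, φ x⟫ > 0` on the sphere, so boundary points stay
-- put and the discriminant `D` is positive on the whole ball, which makes the square root smooth.
open Metric in
theorem exists_zero_of_contDiff_of_norm_sub_lt_one {E : Type*} [NormedAddCommGroup E]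
    [InnerProductSpace ℝ E] [FiniteDimensional ℝ E] [Nontrivial E] {φ : E → E}
    (hφ : ContDiff ℝ 1 φ) (h : ∀ x ∈ closedBall (0 : E) 1, ‖φ x - x‖ < 1) :
    ∃ x ∈ closedBall (0 : E) 1, φ x = 0 := by
  by_contra! hne
  set D : E → ℝ := fun x => inner ℝ x (φ x) ^ 2 + ‖φ x‖ ^ 2 * (1 - ‖x‖ ^ 2) with hD
  have hb : ∀ x, ‖x‖ = 1 → 0 < inner ℝ x (φ x) := by
    intro x hx
    have h1 := h x (by simp [hx])
    have h2 : ‖φ x - x‖ ^ 2 < 1 := by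
      have := norm_nonneg (φ x - x)
      nlinarith
    rw [norm_sub_sq_real, hx, real_inner_comm] at h2
    have h3 : 0 < ‖φ x‖ := norm_pos_iff.2 (hne x (by simp [hx]))
    nlinarith
  have hDpos : ∀ x ∈ closedBall (0 : E) 1, 0 < D x := by
    intro x hx
    rcases lt_or_eq_of_le (mem_closedBall_zero_iff.1 hx) with h1 | h1
    · have h3 : 0 < ‖φ x‖ := norm_pos_iff.2 (hne x hx)
      have : 0 < 1 - ‖x‖ ^ 2 := by nlinarith [norm_nonneg x]
      simp only [hD]
      positivity
    · have := hb x h1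
      simp only [hD, h1]
      simp only [one_pow, sub_self, mul_zero, add_zero]
      positivity
  have hDs : ContDiff ℝ 1 D :=
    ((contDiff_id.inner ℝ hφ).pow 2).add
      ((hφ.norm_sq ℝ).mul (contDiff_const.sub (contDiff_id.norm_sq ℝ)))
  set F : E → E := fun x => x + ((√(D x) - inner ℝ x (φ x)) / ‖φ x‖ ^ 2) • φ x with hF
  refine not_exists_contDiff_retraction_sphere F (fun x hx => ?_) (fun x hx => ?_) (fun x hx => ?_)
  · refine contDiffAt_id.add (ContDiffAt.smul (ContDiffAt.div ?_ (hφ.norm_sq ℝ).contDiffAt ?_)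
      hφ.contDiffAt)
    · exact (hDs.contDiffAt.sqrt (hDpos x hx).ne').sub (contDiff_id.inner ℝ hφ).contDiffAt
    · have := norm_pos_iff.2 (hne x hx)
      positivity
  · have : √(D x) = inner ℝ x (φ x) := by
      simp only [hD, hx]
      simpa using Real.sqrt_sq (hb x hx).le
    simp [hF, this]
  · have ha : ‖φ x‖ ^ 2 ≠ 0 := by
      have := norm_pos_iff.2 (hne x hx)
      positivity
    have hs : √(D x) ^ 2 = inner ℝ x (φ x) ^ 2 + ‖φ x‖ ^ 2 * (1 - ‖x‖ ^ 2) :=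
      Real.sq_sqrt (hDpos x hx).le
    have : ‖F x‖ ^ 2 = 1 := by
      simp only [hF]
      rw [norm_add_sq_real, inner_smul_right, norm_smul, mul_pow, Real.norm_eq_abs, sq_abs]
      generalize √(D x) = s at *
      generalize inner ℝ x (φ x) = b at *
      generalize ‖φ x‖ ^ 2 = a at *
      field_simp
      linear_combination hs
    exact (pow_eq_one_iff_of_nonneg (norm_nonneg _) two_ne_zero).1 this

open Metric in
/-- Radial projection to the closed unit ball. -/
theorem exists_continuous_retraction_closedBall (E : Type*) [NormedAddCommGroup E]
    [NormedSpace ℝ E] : ∃ r : E → E, Continuous r ∧ (∀ x, r x ∈ closedBall 0 1) ∧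
      ∀ x ∈ closedBall 0 1, r x = x := by
  refine ⟨fun x => (max 1 ‖x‖)⁻¹ • x, ?_, fun x => ?_, fun x hx => ?_⟩
  · refine Continuous.smul (Continuous.inv₀ (by fun_prop) fun x => ?_) continuous_id
    have : 1 ≤ max 1 ‖x‖ := le_max_left _ _
    positivity
  · have : 0 < max 1 ‖x‖ := by positivity
    rw [mem_closedBall_zero_iff, norm_smul, norm_inv, Real.norm_of_nonneg this.le,
      inv_mul_le_one₀ this]
    exact le_max_right _ _
  · simp [max_eq_left (mem_closedBall_zero_iff.1 hx)]

open Manifold in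
/-- Uniform approximation of continuous maps by smooth maps. -/
theorem Continuous.exists_contDiff_norm_sub_lt {E F : Type*} [NormedAddCommGroup E]
    [NormedSpace ℝ E] [FiniteDimensional ℝ E] [NormedAddCommGroup F] [NormedSpace ℝ F]
    {ψ : E → F} (hψ : Continuous ψ) {ε : ℝ} (hε : 0 < ε) :
    ∃ g : E → F, ContDiff ℝ 1 g ∧ ∀ x, ‖g x - ψ x‖ < ε := by
  obtain ⟨g, hg⟩ := exists_contMDiffMap_forall_mem_convex_of_local_const (n := 1) (𝓘(ℝ, E))
    (t := fun x => Metric.ball (ψ x) ε) (fun x => convex_ball _ _) (fun x => ⟨ψ x, by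
      filter_upwards [hψ.continuousAt.eventually (Metric.ball_mem_nhds (ψ x) hε)] with y hy
      rwa [Metric.mem_ball, dist_comm]⟩)
  exact ⟨g, g.contMDiff.contDiff, fun x => by simpa [dist_eq_norm] using hg x⟩

open Metric in
/-- A continuous perturbation, of size less than one, of the identity of the closed unit ball has
a zero. -/
theorem ContinuousOn.exists_zero_of_norm_sub_lt_one {E : Type*} [NormedAddCommGroup E]
    [InnerProductSpace ℝ E] [FiniteDimensional ℝ E] [Nontrivial E] {φ : E → E}
    (hφ : ContinuousOn φ (closedBall 0 1)) (h : ∀ x ∈ closedBall (0 : E) 1, ‖φ x - x‖ < 1) :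
    ∃ x ∈ closedBall (0 : E) 1, φ x = 0 := by
  by_contra! hne
  have hK : IsCompact (closedBall (0 : E) 1) := isCompact_closedBall 0 1
  have hKn : (closedBall (0 : E) 1).Nonempty := ⟨0, by simp⟩
  obtain ⟨x₁, hx₁, hmax⟩ := hK.exists_isMaxOn hKn (hφ.sub continuousOn_id).norm
  obtain ⟨x₂, hx₂, hmin⟩ := hK.exists_isMinOn hKn hφ.norm
  obtain ⟨r, hrc, hrm, hr⟩ := exists_continuous_retraction_closedBall E
  have hψ : Continuous (φ ∘ r) := hφ.comp_continuous hrc hrm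
  -- The error is below the minimum of `‖φ‖`, so `g` has no zero in the ball, and below the slack in
  -- `‖φ x - x‖ < 1`, so the smooth case gives one.
  obtain ⟨g, hg, hgφ⟩ := hψ.exists_contDiff_norm_sub_lt
    (ε := min ‖φ x₂‖ (1 - ‖φ x₁ - x₁‖))
    (lt_min (norm_pos_iff.2 (hne x₂ hx₂)) (sub_pos.2 (h x₁ hx₁)))
  obtain ⟨x, hx, hx0⟩ := exists_zero_of_contDiff_of_norm_sub_lt_one hg fun x hx => by
    have h1 : ‖φ x - x‖ ≤ ‖φ x₁ - x₁‖ := hmax hx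
    have h2 := hgφ x
    simp only [Function.comp, hr x hx] at h2
    calc ‖g x - x‖ = ‖(g x - φ x) + (φ x - x)‖ := by abel_nf
      _ ≤ ‖g x - φ x‖ + ‖φ x - x‖ := norm_add_le _ _
      _ < 1 := by linarith [h2.trans_le (min_le_right _ _)]
  have h1 : ‖φ x₂‖ ≤ ‖φ x‖ := hmin hx
  have h2 := hgφ x
  simp only [Function.comp, hr x hx, hx0, zero_sub, norm_neg] at h2
  linarith [h2.trans_le (min_le_left _ _)]

/-! ### Invariance of domain -/

/-- The inverse of a continuous injective map on a compact set extends continuously. -/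
theorem ContinuousOn.exists_continuous_leftInvOn_of_isCompact {E : Type*} [NormedAddCommGroup E]
    [NormedSpace ℝ E] [FiniteDimensional ℝ E] {f : E → E} {K : Set E}
    (hf : ContinuousOn f K) (hK : IsCompact K) (hinj : InjOn f K) :
    ∃ G : E → E, Continuous G ∧ ∀ x ∈ K, G (f x) = x := by
  have : CompactSpace K := isCompact_iff_compactSpace.1 hK
  have he : IsClosedEmbedding (K.domRestrict f) :=
    (continuousOn_iff_continuous_domRestrict.1 hf).isClosedEmbedding (injOn_iff_injective.1 hinj)
  obtain ⟨G, hG⟩ := ContinuousMap.exists_extension' he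
    (⟨Subtype.val, continuous_subtype_val⟩ : C(K, E))
  exact ⟨G, G.continuous, fun x hx => congrFun hG ⟨x, hx⟩⟩

open Metric in
/-- The image of the closed unit ball under a continuous injective map is a neighbourhood of the
image of the centre. -/
theorem ContinuousOn.image_closedBall_mem_nhds {E : Type*} [NormedAddCommGroup E]
    [InnerProductSpace ℝ E] [FiniteDimensional ℝ E] [Nontrivial E] {f : E → E}
    (hf : ContinuousOn f (closedBall 0 1)) (hinj : InjOn f (closedBall 0 1)) :
    f '' closedBall 0 1 ∈ 𝓝 (f 0) := by
  borelize E
  -- Otherwise some `c` close to `f 0` is missed by the image `M`. Let `G` extend the inverse of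
  -- `f`, and let `Φ` push `M` radially out of the ball of radius `d` about `c`. A smooth
  -- approximation `P` of `G`, shifted by a small `w`, has no zero on `Φ(M)`: on the sphere because
  -- `P` maps it to a null set, elsewhere because `‖G‖ ≥ m`. But `(P - w) ∘ Φ ∘ f` is within
  -- distance 1 of the identity, hence has a zero.
  by_contra hnot
  have hK : IsCompact (closedBall (0 : E) 1) := isCompact_closedBall 0 1
  set M := f '' closedBall (0 : E) 1 with hM
  have hMc : IsCompact M := hK.image_of_continuousOn hf
  obtain ⟨G, hGc, hG⟩ := hf.exists_continuous_leftInvOn_of_isCompact hK hinj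
  have h0K : (0 : E) ∈ closedBall (0 : E) 1 := by simp
  have hG0 : G (f 0) = 0 := hG 0 h0K
  obtain ⟨δ, hδ, hδG⟩ := Metric.continuousAt_iff.1 (hGc.continuousAt (x := f 0)) (1 / 8) (by norm_num)
  obtain ⟨c, hcδ, hcM⟩ : ∃ c ∈ ball (f 0) (δ / 2), c ∉ M := by
    by_contra! hall
    exact hnot (mem_of_superset (ball_mem_nhds _ (half_pos hδ)) hall)
  set d := δ / 2 with hd
  have hd0 : 0 < d := half_pos hδ
  have hGsmall : ∀ y, ‖y - c‖ ≤ d → ‖G y‖ < 1 / 8 := by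
    intro y hy
    have : dist y (f 0) < δ := by
      calc dist y (f 0) ≤ dist y c + dist c (f 0) := dist_triangle _ _ _
        _ < d + d := by rw [dist_eq_norm]; exact add_lt_add_of_le_of_lt hy hcδ
        _ = δ := by rw [hd]; ring
    simpa [hG0] using hδG this
  set S₁ := M ∩ {y | d ≤ ‖y - c‖} with hS₁
  have hS₁c : IsCompact S₁ :=
    hMc.inter_right (isClosed_le continuous_const (by fun_prop))
  have hGne : ∀ y ∈ S₁, G y ≠ 0 := by
    rintro _ ⟨⟨x, hx, rfl⟩, hy⟩ h0
    rw [hG x hx] at h0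
    subst h0
    rw [mem_ball, dist_comm, dist_eq_norm] at hcδ
    exact absurd hcδ (not_lt.2 hy)
  obtain ⟨m, hm, hmG⟩ : ∃ m : ℝ, 0 < m ∧ ∀ y ∈ S₁, m ≤ ‖G y‖ := by
    rcases S₁.eq_empty_or_nonempty with he | hn
    · exact ⟨1, one_pos, by simp [he]⟩
    · obtain ⟨y, hy, hmin⟩ := hS₁c.exists_isMinOn hn hGc.norm.continuousOn
      exact ⟨‖G y‖, norm_pos_iff.2 (hGne y hy), fun z hz => hmin hz⟩
  -- The total error `2 * ε` is at most `m`, which excludes zeros on `S₁`, and at most `1 / 8`,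
  -- which leaves room in the distance to the identity.
  set ε := min m (1 / 8) / 2 with hε
  have hε0 : 0 < ε := by positivity
  have hεm : 2 * ε ≤ m := by rw [hε]; linarith [min_le_left m (1 / 8)]
  have hε8 : 2 * ε ≤ 1 / 8 := by rw [hε]; linarith [min_le_right m (1 / 8)]
  obtain ⟨P, hP, hPG⟩ := hGc.exists_contDiff_norm_sub_lt hε0
  have hnull : (volume : Measure E) (P '' sphere c d) = 0 :=
    addHaar_image_eq_zero_of_differentiableOn_of_addHaar_eq_zero _
      (hP.differentiable (by norm_num)).differentiableOn (Measure.addHaar_sphere _ _ _)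
  obtain ⟨w, hwε, hw⟩ : ∃ w ∈ ball (0 : E) ε, w ∉ P '' sphere c d := by
    by_contra! hall
    exact (measure_ball_pos volume (0 : E) hε0).ne' (measure_mono_null hall hnull)
  rw [mem_ball_zero_iff] at hwε
  have hQG : ∀ y, ‖P y - w - G y‖ < 2 * ε := by
    intro y
    calc ‖P y - w - G y‖ = ‖(P y - G y) - w‖ := by abel_nf
      _ ≤ ‖P y - G y‖ + ‖w‖ := norm_sub_le _ _
      _ < 2 * ε := by linarith [hPG y]
  -- push `M` away from `c`
  set Φ : E → E := fun y => c + max (d / ‖y - c‖) 1 • (y - c) with hΦ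
  have hΦc : ContinuousOn Φ M := by
    refine continuousOn_const.add (ContinuousOn.smul (ContinuousOn.sup
      (continuousOn_const.div (by fun_prop) fun y hy => ?_) continuousOn_const) (by fun_prop))
    rw [norm_ne_zero_iff, sub_ne_zero]
    rintro rfl
    exact hcM hy
  have hΦ1 : ∀ y, d ≤ ‖y - c‖ → Φ y = y := by
    intro y hy
    have : d / ‖y - c‖ ≤ 1 := div_le_one_of_le₀ hy (norm_nonneg _)
    simp [hΦ, max_eq_right this]
  have hΦ2 : ∀ y ∈ M, ‖y - c‖ ≤ d → ‖Φ y - c‖ = d := by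
    intro y hyM hy
    have hpos : 0 < ‖y - c‖ := by
      rw [norm_pos_iff, sub_ne_zero]
      rintro rfl
      exact hcM hyM
    have : 1 ≤ d / ‖y - c‖ := (one_le_div hpos).2 hy
    simp only [hΦ, max_eq_left this, add_sub_cancel_left, norm_smul]
    rw [Real.norm_of_nonneg (by positivity), div_mul_cancel₀ _ hpos.ne']
  obtain ⟨x, hx, hx0⟩ := ContinuousOn.exists_zero_of_norm_sub_lt_one
    (φ := fun x => P (Φ (f x)) - w)
    ((hP.continuous.comp_continuousOn (hΦc.comp hf (mapsTo_image f _))).sub continuousOn_const)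
    (fun x hx => by
      have hfx : f x ∈ M := mem_image_of_mem f hx
      rcases le_total d ‖f x - c‖ with h1 | h1
      · have := hQG (f x)
        rw [hG x hx] at this
        rw [hΦ1 _ h1]
        linarith
      · have h2 := hQG (Φ (f x))
        have h3 := hGsmall (Φ (f x)) (hΦ2 _ hfx h1).le
        have h4 := hGsmall (f x) h1
        rw [hG x hx] at h4
        calc ‖P (Φ (f x)) - w - x‖
            = ‖(P (Φ (f x)) - w - G (Φ (f x))) + G (Φ (f x)) - x‖ := by abel_nf
          _ ≤ ‖P (Φ (f x)) - w - G (Φ (f x))‖ + ‖G (Φ (f x))‖ + ‖x‖ :=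
            (norm_sub_le _ _).trans (by gcongr; exact norm_add_le _ _)
          _ < 1 := by linarith)
  have hfx : f x ∈ M := mem_image_of_mem f hx
  rcases le_total d ‖f x - c‖ with h1 | h1
  · have h2 := hQG (f x)
    simp only [hΦ1 _ h1] at hx0
    rw [hx0, zero_sub, norm_neg] at h2
    linarith [hmG (f x) ⟨hfx, h1⟩]
  · exact hw ⟨Φ (f x), by simpa [dist_eq_norm] using hΦ2 _ hfx h1, sub_eq_zero.1 hx0⟩

open Metric in
/-- **Invariance of domain**. -/
theorem IsOpen.image_of_continuousOn_injOn {E : Type*} [NormedAddCommGroup E]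
    [InnerProductSpace ℝ E] [FiniteDimensional ℝ E] [Nontrivial E] {f : E → E} {U : Set E}
    (hU : IsOpen U) (hf : ContinuousOn f U) (hinj : InjOn f U) : IsOpen (f '' U) := by
  rw [isOpen_iff_mem_nhds]
  rintro _ ⟨x, hx, rfl⟩
  obtain ⟨r, hr, hrU⟩ := nhds_basis_closedBall.mem_iff.1 (hU.mem_nhds hx)
  have hmaps : MapsTo (fun z : E => x + r • z) (closedBall 0 1) U := by
    intro z hz
    refine hrU ?_
    rw [mem_closedBall_zero_iff] at hz
    rw [mem_closedBall, dist_eq_norm, add_sub_cancel_left, norm_smul, Real.norm_of_nonneg hr.le]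
    exact mul_le_of_le_one_right hr.le hz
  have := ContinuousOn.image_closedBall_mem_nhds (f := fun z => f (x + r • z))
    (hf.comp (by fun_prop) hmaps) (fun z hz z' hz' h => by
      have := hinj (hmaps hz) (hmaps hz') h
      exact smul_right_injective E hr.ne' (add_left_cancel this))
  simp only [smul_zero, add_zero] at this
  refine mem_of_superset this ?_
  rintro _ ⟨z, hz, rfl⟩
  exact mem_image_of_mem f (hmaps hz)

/-! ### Radial segments and their line integrals -/

open Metric in
/-- Every ray from `f 0 = 0` contains a segment that joins the images of two given spheres and
stays in the image of the ball. -/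
theorem exists_radial_segment {E : Type*} [NormedAddCommGroup E]
    [InnerProductSpace ℝ E] [FiniteDimensional ℝ E] [Nontrivial E] {f : E → E} {r₁ r : ℝ}
    (hf : ContinuousOn f (closedBall 0 r)) (hinj : InjOn f (closedBall 0 r)) (hf0 : f 0 = 0)
    (hr₁ : 0 < r₁) (hr : r₁ < r) {θ : E} (hθ : ‖θ‖ = 1) :
    ∃ a b : ℝ, 0 < a ∧ a < b ∧ a • θ ∈ f '' sphere 0 r₁ ∧ b • θ ∈ f '' sphere 0 r ∧
      ∀ t ∈ Icc a b, t • θ ∈ f '' closedBall 0 r := by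
  have hr0 : 0 < r := hr₁.trans hr
  have hK : IsCompact (closedBall (0 : E) r) := isCompact_closedBall 0 r
  have h0K : (0 : E) ∈ closedBall (0 : E) r := by simp [hr0.le]
  have hcθ : Continuous fun t : ℝ => t • θ := by fun_prop
  set V : Set ℝ := (fun t : ℝ => t • θ) ⁻¹' (f '' ball 0 r) with hV
  set W : Set ℝ := (fun t : ℝ => t • θ) ⁻¹' (f '' closedBall 0 r) with hW
  set S : Set ℝ := (fun t : ℝ => t • θ) ⁻¹' (f '' sphere 0 r) with hS
  have hVo : IsOpen V := (isOpen_ball.image_of_continuousOn_injOn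
    (hf.mono ball_subset_closedBall) (hinj.mono ball_subset_closedBall)).preimage hcθ
  have hKc : IsCompact (f '' closedBall 0 r) := hK.image_of_continuousOn hf
  have hWc : IsClosed W := hKc.isClosed.preimage hcθ
  have hSc : IsClosed S := ((isCompact_sphere 0 r).image_of_continuousOn
    (hf.mono sphere_subset_closedBall)).isClosed.preimage hcθ
  have hWVS : W ⊆ V ∪ S := by
    rintro t ⟨x, hx, hxt⟩
    rw [← ball_union_sphere] at hx
    exact hx.imp (fun h => ⟨x, h, hxt⟩) (fun h => ⟨x, h, hxt⟩)
  have hVW : V ⊆ W := preimage_mono (image_mono ball_subset_closedBall)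
  have h0V : (0 : ℝ) ∈ V := ⟨0, by simp [hr0], by simp [hf0]⟩
  -- Off `S`, the line of parameters splits into the disjoint open sets `V` and `Wᶜ`. Openness of
  -- `V` is where invariance of domain enters.
  have hconn : ∀ I : Set ℝ, IsPreconnected I → (0 : ℝ) ∈ I → Disjoint I S → I ⊆ V := by
    intro I hI h0 hIS
    refine hI.subset_left_of_subset_union hVo hWc.isOpen_compl
      (disjoint_compl_right_iff_subset.2 hVW) (fun t ht => ?_) ⟨0, h0, h0V⟩
    by_cases htW : t ∈ W
    · exact (hWVS htW).imp_right fun h => (disjoint_left.1 hIS ht h).elim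
    · exact Or.inr htW
  have hne : (Ici 0 ∩ S).Nonempty := by
    by_contra hne
    have hsub := hconn (Ici 0) isPreconnected_Ici self_mem_Ici
      (disjoint_iff_inter_eq_empty.2 (not_nonempty_iff_eq_empty.1 hne))
    obtain ⟨R, hR⟩ := hKc.isBounded.exists_norm_le
    have h1 := hR _ (hVW (hsub (show |R| + 1 ∈ Ici (0 : ℝ) from by
      have := abs_nonneg R
      rw [mem_Ici]; linarith)))
    rw [norm_smul, hθ, mul_one, Real.norm_of_nonneg (by positivity)] at h1
    linarith [le_abs_self R]
  -- The first exit time. Up to `b` the ray stays in the image, so the norm of the preimage runs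
  -- continuously from 0 to `r` and takes the value `r₁` at some `a`.
  set b := sInf (Ici 0 ∩ S) with hb
  have hbS : b ∈ Ici 0 ∩ S := (isClosed_Ici.inter hSc).csInf_mem hne ⟨0, fun t ht => ht.1⟩
  have hb0 : 0 ≤ b := hbS.1
  have hbne : b ≠ 0 := by
    intro h
    obtain ⟨x, hx, hx0⟩ := hbS.2
    have : x = 0 := hinj (sphere_subset_closedBall hx) h0K (by simpa [h, hf0] using hx0)
    rw [this, mem_sphere, dist_self] at hx
    linarith
  have hbpos : 0 < b := lt_of_le_of_ne hb0 hbne.symm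
  have hIco : Ico 0 b ⊆ V := by
    refine hconn _ isPreconnected_Ico ⟨le_rfl, hbpos⟩ (disjoint_left.2 fun t ht htS => ?_)
    exact absurd (csInf_le ⟨0, fun t ht => ht.1⟩ (show t ∈ Ici 0 ∩ S from ⟨ht.1, htS⟩))
      (not_le.2 ht.2)
  have hIcc : Icc 0 b ⊆ W := by
    intro t ht
    rcases lt_or_eq_of_le ht.2 with h | h
    · exact hVW (hIco ⟨ht.1, h⟩)
    · rw [h]
      exact preimage_mono (image_mono sphere_subset_closedBall) hbS.2
  obtain ⟨G, hGc, hG⟩ := hf.exists_continuous_leftInvOn_of_isCompact hK hinj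
  have hu0 : ‖G ((0 : ℝ) • θ)‖ = 0 := by
    have := hG 0 h0K
    rw [hf0] at this
    simp [this]
  have hub : ‖G (b • θ)‖ = r := by
    obtain ⟨x, hx, hx0⟩ := hbS.2
    simp only at hx0
    rw [← hx0, hG x (sphere_subset_closedBall hx)]
    simpa using hx
  obtain ⟨a, ha, hua⟩ := intermediate_value_Icc hb0
    (f := fun t : ℝ => ‖G (t • θ)‖) (by fun_prop) (show r₁ ∈ Icc _ _ by
      simp only [hu0, hub]; exact ⟨hr₁.le, hr.le⟩)
  simp only at hua
  have ha0 : a ≠ 0 := by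
    rintro rfl
    linarith
  have hab : a ≠ b := by
    rintro h
    rw [h] at hua
    linarith
  refine ⟨a, b, lt_of_le_of_ne ha.1 ha0.symm, lt_of_le_of_ne ha.2 hab, ?_, hbS.2,
    fun t ht => hIcc ⟨ha.1.trans ht.1, ht.2⟩⟩
  obtain ⟨x, hx, hxa⟩ := hIcc ha
  simp only at hxa
  rw [← hxa, hG x hx] at hua
  exact ⟨x, by simpa using hua, hxa⟩

theorem eVariationOn_smul_const {E : Type*} [NormedAddCommGroup E] [NormedSpace ℝ E] {θ : E}
    (hθ : ‖θ‖ = 1) {a b : ℝ} (hab : a ≤ b) :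
    eVariationOn (fun t : ℝ => t • θ) (Icc a b) = ENNReal.ofReal (b - a) := by
  refine le_antisymm ?_ ?_
  · have h1 : LipschitzOnWith 1 (fun t : ℝ => t • θ) univ :=
      LipschitzOnWith.of_dist_le_mul fun x _ y _ => by
        rw [dist_eq_norm, dist_eq_norm, ← sub_smul, norm_smul, hθ]; simp
    have h2 := h1.comp_eVariationOn_le (g := id) (mapsTo_univ _ (Icc a b))
    have h3 := (monotone_id.monotoneOn (Icc a b)).eVariationOn_eq (left_mem_Icc.2 hab)
      (right_mem_Icc.2 hab)
    rw [inter_self] at h3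
    simpa using h2.trans (mul_le_mul_right h3.le _)
  · have := eVariationOn.edist_le (fun t : ℝ => t • θ) (left_mem_Icc.2 hab) (right_mem_Icc.2 hab)
    refine le_trans (le_of_eq ?_) this
    rw [edist_comm, edist_dist, dist_eq_norm, ← sub_smul, norm_smul, hθ, mul_one,
      Real.norm_of_nonneg (sub_nonneg.2 hab)]

/-- The radial segment from `a • θ` to `b • θ`. -/
def ClosedCurve.radial {n : ℕ} (θ : EuclideanSpace ℝ (Fin n)) {a b : ℝ} (hab : a < b) :
    ClosedCurve n where
  a := a
  b := b
  lt := hab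
  toFun := fun t => t • θ
  continuousOn := by fun_prop

theorem ClosedCurve.locallyRectifiable_radial {n : ℕ} {θ : EuclideanSpace ℝ (Fin n)}
    (hθ : ‖θ‖ = 1) {a b : ℝ} (hab : a < b) : (ClosedCurve.radial θ hab).LocallyRectifiable := by
  refine BoundedVariationOn.locallyBoundedVariationOn ?_
  change eVariationOn (fun t : ℝ => t • θ) (Icc a b) ≠ ∞
  rw [eVariationOn_smul_const hθ hab.le]
  exact ENNReal.ofReal_ne_top

/-- For a unit vector `θ` the arc length from `a • θ` to `t • θ` is `t - a`, so the natural
parametrization is a translation of the parameter. -/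
theorem ClosedCurve.lineIntegral_radial {n : ℕ} {θ : EuclideanSpace ℝ (Fin n)}
    (hθ : ‖θ‖ = 1) {a b : ℝ} (hab : a < b) (ρ : EuclideanSpace ℝ (Fin n) → ℝ≥0∞) :
    (ClosedCurve.radial θ hab).lineIntegral ρ = ∫⁻ t in Icc a b, ρ (t • θ) := by
  have hnat : ∀ s ∈ Icc 0 (b - a),
      naturalParameterization (fun t : ℝ => t • θ) (Icc a b) a s = (a + s) • θ := by
    intro s hs
    have hmem : a + s ∈ Icc a b := ⟨by linarith [hs.1], by linarith [hs.2]⟩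
    have h := edist_naturalParameterization_eq_zero (locallyRectifiable_radial hθ hab)
      (left_mem_Icc.2 hab.le) hmem
    have hv : variationOnFromTo (fun t : ℝ => t • θ) (Icc a b) a (a + s) = s := by
      rw [variationOnFromTo.eq_of_le _ _ hmem.1, Icc_inter_Icc, sup_idem, inf_eq_right.2 hmem.2,
        eVariationOn_smul_const hθ hmem.1, add_sub_cancel_left, ENNReal.toReal_ofReal hs.1]
    change edist (naturalParameterization (fun t : ℝ => t • θ) (Icc a b) a
      (variationOnFromTo (fun t : ℝ => t • θ) (Icc a b) a (a + s))) ((a + s) • θ) = 0 at h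
    rwa [hv, edist_eq_zero] at h
  have hlen : (ClosedCurve.radial θ hab).length.toReal = b - a := by
    change (eVariationOn (fun t : ℝ => t • θ) (Icc a b)).toReal = b - a
    rw [eVariationOn_smul_const hθ hab.le, ENNReal.toReal_ofReal (sub_nonneg.2 hab.le)]
  rw [ClosedCurve.lineIntegral, hlen]
  calc _ = ∫⁻ s in Icc 0 (b - a), ρ ((a + s) • θ) :=
        setLIntegral_congr_fun measurableSet_Icc fun s hs => by
          exact congrArg ρ (hnat s hs)
    _ = ∫⁻ s in (fun s => a + s) ⁻¹' Icc a b, ρ ((a + s) • θ) := by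
        rw [preimage_const_add_Icc, sub_self]
    _ = _ := (measurePreserving_add_left volume a).setLIntegral_comp_preimage_emb
        (measurableEmbedding_addLeft a) (fun t => ρ (t • θ)) _

/-! ### Polar coordinates and the two modulus estimates -/

open Metric in
/-- Integration in polar coordinates. -/
theorem lintegral_eq_lintegral_sphere_lintegral_Ioi {E : Type*} [NormedAddCommGroup E]
    [InnerProductSpace ℝ E] [FiniteDimensional ℝ E] [MeasurableSpace E] [BorelSpace E]
    [Nontrivial E] {g : E → ℝ≥0∞} (hg : Measurable g) :
    ∫⁻ x, g x = ∫⁻ θ, (∫⁻ t in Ioi (0 : ℝ),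
      ENNReal.ofReal (t ^ (Module.finrank ℝ E - 1)) * g (t • (θ : E)))
        ∂(volume : Measure E).toSphere := by
  set μ : Measure E := volume
  have hmp := μ.measurePreserving_homeomorphUnitSphereProd
  have hmeas : Measurable fun q : sphere (0 : E) 1 × Ioi (0 : ℝ) => g ((q.2 : ℝ) • (q.1 : E)) :=
    hg.comp (by fun_prop)
  calc ∫⁻ x, g x ∂μ = ∫⁻ x : ({0}ᶜ : Set E), g x ∂(μ.comap (↑)) := by
        rw [lintegral_subtype_comap (measurableSet_singleton _).compl, restrict_compl_singleton]
    _ = ∫⁻ q, g ((q.2 : ℝ) • (q.1 : E))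
          ∂(μ.toSphere.prod (Measure.volumeIoiPow (Module.finrank ℝ E - 1))) := by
        rw [← hmp.lintegral_comp hmeas]
        refine lintegral_congr fun x => ?_
        congr 1
        have hx : ‖(x : E)‖ ≠ 0 := norm_ne_zero_iff.2 x.2
        simp [smul_smul, mul_inv_cancel₀ hx]
    _ = ∫⁻ θ, (∫⁻ t, g ((t : ℝ) • (θ : E)) ∂(Measure.volumeIoiPow (Module.finrank ℝ E - 1)))
          ∂μ.toSphere := lintegral_prod _ hmeas.aemeasurable
    _ = _ := by
        refine lintegral_congr fun θ => ?_
        have hm : Measurable fun t : Ioi (0 : ℝ) => g ((t : ℝ) • (θ : E)) :=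
          hg.comp (by fun_prop)
        rw [Measure.volumeIoiPow, lintegral_withDensity_eq_lintegral_mul _ (by fun_prop) hm]
        exact lintegral_subtype_comap measurableSet_Ioi
          (fun t : ℝ => ENNReal.ofReal (t ^ (Module.finrank ℝ E - 1)) * g (t • (θ : E)))

theorem lintegral_Ioc_ofReal_rpow_sub_one {α : ℝ} (hα : 0 < α) {a b : ℝ} (ha : 0 ≤ a)
    (hab : a ≤ b) :
    ∫⁻ t in Ioc a b, ENNReal.ofReal (t ^ (α - 1)) = ENNReal.ofReal ((b ^ α - a ^ α) / α) := by
  have hint : IntervalIntegrable (fun t : ℝ => t ^ (α - 1)) volume a b :=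
    intervalIntegral.intervalIntegrable_rpow' (by linarith)
  rw [← ofReal_integral_eq_lintegral_ofReal hint.1, ← intervalIntegral.integral_of_le hab,
    integral_rpow (Or.inl (by linarith)), sub_add_cancel]
  exact (ae_restrict_iff' measurableSet_Ioc).2
    (.of_forall fun t ht => Real.rpow_nonneg (ha.trans ht.1.le) _)

/-- The Hölder estimate along a ray. -/
theorem ofReal_rpow_le_lintegral_pow_mul_rpow {n : ℕ} (hn : 2 ≤ n) {p : ℝ} (hp : (n : ℝ) < p)
    {L : ℝ} (hL : 0 < L) {h : ℝ → ℝ≥0∞} (hh : Measurable h)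
    (h1 : 1 ≤ ∫⁻ t in Ioc 0 L, h t) :
    ENNReal.ofReal ((L ^ ((p - n) / (p - 1)) / ((p - n) / (p - 1))) ^ (1 - p)) ≤
      ∫⁻ t in Ioi 0, ENNReal.ofReal (t ^ (n - 1)) * h t ^ p := by
  have hn' : (2 : ℝ) ≤ n := by exact_mod_cast hn
  have hp1 : 0 < p - 1 := by linarith
  have hp0 : 0 < p := by linarith
  set α := (p - n) / (p - 1) with hαdef
  have hα : 0 < α := div_pos (by linarith) hp1
  set q := p / (p - 1) with hq
  have hq0 : 0 < q := div_pos hp0 hp1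
  have hpq : p.HolderConjugate q := Real.HolderConjugate.conjExponent (by linarith)
  -- The weights are reciprocal for `t > 0`; `w ^ p` is the polar Jacobian `t ^ (n - 1)`, and `w' ^
  -- q = t ^ (α - 1)`.
  set w : ℝ → ℝ≥0∞ := fun t => ENNReal.ofReal (t ^ (((n : ℝ) - 1) / p)) with hw
  set w' : ℝ → ℝ≥0∞ := fun t => ENNReal.ofReal (t ^ (-(((n : ℝ) - 1) / p))) with hw'
  have hwm : Measurable w := by fun_prop
  have hwm' : Measurable w' := by fun_prop
  have hJ : ∫⁻ t in Ioc 0 L, w' t ^ q = ENNReal.ofReal (L ^ α / α) := by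
    have := lintegral_Ioc_ofReal_rpow_sub_one hα le_rfl hL.le
    rw [Real.zero_rpow hα.ne', sub_zero] at this
    rw [← this]
    refine setLIntegral_congr_fun measurableSet_Ioc fun t ht => ?_
    simp only [hw']
    rw [ENNReal.ofReal_rpow_of_nonneg (Real.rpow_nonneg ht.1.le _) hq0.le,
      ← Real.rpow_mul ht.1.le]
    congr 2
    rw [hq, hαdef]
    field_simp
    ring
  set A := ∫⁻ t in Ioi 0, ENNReal.ofReal (t ^ (n - 1)) * h t ^ p with hA
  have hAle : ∫⁻ t in Ioc 0 L, (w t * h t) ^ p ≤ A := by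
    calc _ = ∫⁻ t in Ioc 0 L, ENNReal.ofReal (t ^ (n - 1)) * h t ^ p := by
          refine setLIntegral_congr_fun measurableSet_Ioc fun t ht => ?_
          simp only [hw]
          rw [ENNReal.mul_rpow_of_nonneg _ _ hp0.le,
            ENNReal.ofReal_rpow_of_nonneg (Real.rpow_nonneg ht.1.le _) hp0.le,
            ← Real.rpow_mul ht.1.le, div_mul_cancel₀ _ hp0.ne', ← Real.rpow_natCast,
            Nat.cast_sub (by omega), Nat.cast_one]
      _ ≤ A := lintegral_mono_set Ioc_subset_Ioi_self
  have hhol := ENNReal.lintegral_mul_le_Lp_mul_Lq (volume.restrict (Ioc 0 L)) hpq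
    (hwm.mul hh).aemeasurable hwm'.aemeasurable
  have hprod : ∫⁻ t in Ioc 0 L, ((w * h) * w') t = ∫⁻ t in Ioc 0 L, h t := by
    refine setLIntegral_congr_fun measurableSet_Ioc fun t ht => ?_
    simp only [Pi.mul_apply, hw, hw']
    rw [mul_right_comm, ← ENNReal.ofReal_mul (Real.rpow_nonneg ht.1.le _), ← Real.rpow_add ht.1,
      add_neg_cancel, Real.rpow_zero, ENNReal.ofReal_one, one_mul]
  rw [hprod, hJ] at hhol
  have hJpos : 0 < L ^ α / α := div_pos (Real.rpow_pos_of_pos hL _) hα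
  have h2 : 1 ≤ A ^ (1 / p) * ENNReal.ofReal (L ^ α / α) ^ (1 / q) :=
    (h1.trans hhol).trans (by gcongr; exact hAle)
  have h3 := ENNReal.rpow_le_rpow h2 hp0.le
  rw [ENNReal.one_rpow, ENNReal.mul_rpow_of_nonneg _ _ hp0.le, ← ENNReal.rpow_mul,
    ← ENNReal.rpow_mul, one_div_mul_cancel hp0.ne', ENNReal.rpow_one,
    show 1 / q * p = p - 1 by rw [hq]; field_simp,
    ENNReal.ofReal_rpow_of_pos hJpos] at h3
  rw [show 1 - p = -(p - 1) by ring, Real.rpow_neg hJpos.le,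
    ENNReal.ofReal_inv_of_pos (Real.rpow_pos_of_pos hJpos _)]
  rw [ENNReal.inv_le_iff_le_mul]
  · rwa [mul_comm]
  · intro _; exact (ENNReal.ofReal_pos.2 (Real.rpow_pos_of_pos hJpos _)).ne'
  · intro h; exact absurd h ENNReal.ofReal_ne_top

open Metric in
/-- If every ray from the origin meets a segment of radial extent at most `L` that belongs to the
family `Γ`, then the `p`-modulus of `Γ` is at least that of the punctured ball of radius `L`. -/
theorem le_pModulus_of_radial {n : ℕ} (hn : 2 ≤ n) {p : ℝ} (hp : (n : ℝ) < p) {L : ℝ}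
    (hL : 0 < L) {Γ : Set (ClosedCurve n)}
    (hΓ : ∀ θ : EuclideanSpace ℝ (Fin n), ‖θ‖ = 1 → ∃ (a b : ℝ) (hab : a < b), 0 < a ∧ b ≤ L ∧
      ClosedCurve.radial θ hab ∈ Γ) :
    ENNReal.ofReal ((L ^ ((p - n) / (p - 1)) / ((p - n) / (p - 1))) ^ (1 - p)) *
      (volume : Measure (EuclideanSpace ℝ (Fin n))).toSphere univ ≤ pModulus p Γ := by
  have : Nonempty (Fin n) := ⟨⟨0, by omega⟩⟩
  refine le_iInf₂ fun ρ hρ => ?_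
  rw [lintegral_eq_lintegral_sphere_lintegral_Ioi (hρ.1.pow_const p), finrank_euclideanSpace_fin,
    ← lintegral_const]
  refine lintegral_mono fun θ => ?_
  have hθ : ‖(θ : EuclideanSpace ℝ (Fin n))‖ = 1 := by simp
  refine ofReal_rpow_le_lintegral_pow_mul_rpow hn hp hL (hρ.1.comp (by fun_prop)) ?_
  obtain ⟨a, b, hab, ha, hb, hmem⟩ := hΓ θ hθ
  have h1 := hρ.2 _ hmem (ClosedCurve.locallyRectifiable_radial hθ hab)
  rw [ClosedCurve.lineIntegral_radial hθ hab] at h1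
  -- Enlarging `[a, b]` to `(0, L]` makes the bound the same in all directions.
  exact h1.trans (lintegral_mono_set fun t ht => ⟨ha.trans_le ht.1, ht.2.trans hb⟩)

open Metric in
/-- The weighted energy of the extremal radial density of a spherical ring. -/
theorem exists_radial_density {n : ℕ} (hn : 2 ≤ n) {p : ℝ} (hp : (n : ℝ) < p) {r₁ r : ℝ}
    (hr₁ : 0 < r₁) (hr : r₁ < r) :
    ∃ η : ℝ → ℝ≥0∞, Measurable η ∧ ∫⁻ t in Ioo r₁ r, η t = 1 ∧
      ∫⁻ x in sphericalRing (0 : EuclideanSpace ℝ (Fin n)) r₁ r, η ‖x‖ ^ p =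
        ENNReal.ofReal (((r ^ ((p - n) / (p - 1)) - r₁ ^ ((p - n) / (p - 1))) /
          ((p - n) / (p - 1))) ^ (1 - p)) *
        (volume : Measure (EuclideanSpace ℝ (Fin n))).toSphere univ := by
  have : Nonempty (Fin n) := ⟨⟨0, by omega⟩⟩
  have hn' : (2 : ℝ) ≤ n := by exact_mod_cast hn
  have hp1 : 0 < p - 1 := by linarith
  have hp0 : 0 < p := by linarith
  set α := (p - n) / (p - 1) with hαdef
  have hα : 0 < α := div_pos (by linarith) hp1
  set J := (r ^ α - r₁ ^ α) / α with hJdef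
  have hJ : 0 < J := div_pos (sub_pos.2 (Real.rpow_lt_rpow hr₁.le hr hα)) hα
  have hI : ∫⁻ t in Ioo r₁ r, ENNReal.ofReal (t ^ (α - 1)) = ENNReal.ofReal J := by
    rw [restrict_Ioo_eq_restrict_Ioc]
    exact lintegral_Ioc_ofReal_rpow_sub_one hα hr₁.le hr.le
  -- The equality case of Hölder: `t ^ (n - 1) * t ^ ((α - 1) * p) = t ^ (α - 1)`, so the energy per
  -- direction is `J ^ (-p) * J`.
  set η : ℝ → ℝ≥0∞ := fun t => ENNReal.ofReal J⁻¹ * ENNReal.ofReal (t ^ (α - 1)) with hη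
  have hηm : Measurable η := by fun_prop
  refine ⟨η, hηm, ?_, ?_⟩
  · rw [lintegral_const_mul _ (by fun_prop), hI, ← ENNReal.ofReal_mul (inv_nonneg.2 hJ.le),
      inv_mul_cancel₀ hJ.ne', ENNReal.ofReal_one]
  · have hms : MeasurableSet (sphericalRing (0 : EuclideanSpace ℝ (Fin n)) r₁ r) := by
      have h1 : Measurable fun x : EuclideanSpace ℝ (Fin n) => dist x 0 := by fun_prop
      exact h1 measurableSet_Ioo
    have hm : Measurable ((sphericalRing (0 : EuclideanSpace ℝ (Fin n)) r₁ r).indicator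
        fun x => η ‖x‖ ^ p) := ((hηm.comp measurable_norm).pow_const p).indicator hms
    rw [← lintegral_indicator hms, lintegral_eq_lintegral_sphere_lintegral_Ioi hm,
      finrank_euclideanSpace_fin, ← lintegral_const]
    refine lintegral_congr fun θ => ?_
    have hθ : ‖(θ : EuclideanSpace ℝ (Fin n))‖ = 1 := by simp
    have hsub : Ioo r₁ r ⊆ Ioi 0 := fun t ht => hr₁.trans ht.1
    calc _ = ∫⁻ t in Ioi 0, (Ioo r₁ r).indicator
          (fun t => ENNReal.ofReal (J⁻¹ ^ p) * ENNReal.ofReal (t ^ (α - 1))) t := by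
          refine setLIntegral_congr_fun measurableSet_Ioi fun t ht => ?_
          have ht0 : 0 < t := ht
          have hnorm : ‖t • (θ : EuclideanSpace ℝ (Fin n))‖ = t := by
            rw [norm_smul, hθ, mul_one, Real.norm_of_nonneg ht0.le]
          by_cases htI : t ∈ Ioo r₁ r
          · rw [indicator_of_mem htI, indicator_of_mem (by
              simpa [sphericalRing, dist_zero_right, hnorm] using htI), hnorm]
            simp only [hη]
            rw [ENNReal.mul_rpow_of_nonneg _ _ hp0.le,
              ENNReal.ofReal_rpow_of_nonneg (inv_nonneg.2 hJ.le) hp0.le,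
              ENNReal.ofReal_rpow_of_nonneg (Real.rpow_nonneg ht0.le _) hp0.le,
              mul_left_comm, ← ENNReal.ofReal_mul (pow_nonneg ht0.le _),
              ← Real.rpow_mul ht0.le, ← Real.rpow_natCast, ← Real.rpow_add ht0,
              Nat.cast_sub (by omega), Nat.cast_one]
            congr 3
            rw [hαdef]
            field_simp
            ring
          · rw [indicator_of_notMem htI, indicator_of_notMem (fun h => htI (by
              simpa [sphericalRing, dist_zero_right, hnorm] using h)), mul_zero]
      _ = ENNReal.ofReal (J⁻¹ ^ p) * ENNReal.ofReal J := by
          rw [setLIntegral_indicator measurableSet_Ioo, inter_eq_left.2 hsub,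
            lintegral_const_mul _ (by fun_prop), hI]
      _ = ENNReal.ofReal (J ^ (1 - p)) := by
          rw [← ENNReal.ofReal_mul (by positivity), Real.inv_rpow hJ.le, Real.rpow_sub hJ,
            Real.rpow_one]
          congr 1
          ring

/-! ### Distortion of spheres and the conclusion -/

open Metric in
/-- Distortion of spheres: a bound for `‖f x‖` on the sphere of radius `r`. -/
theorem IsRingQHomeomorphismAt.rpow_le_mul_rpow {n : ℕ} (hn : 2 ≤ n) {p : ℝ} (hp : (n : ℝ) < p)
    {Q : EuclideanSpace ℝ (Fin n) → ℝ≥0∞}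
    {f : EuclideanSpace ℝ (Fin n) → EuclideanSpace ℝ (Fin n)}
    (hf : IsRingQHomeomorphismAt p (ball 0 1) Q f 0) (hf0 : f 0 = 0) {K : ℝ} (hK : 0 < K)
    (hQ : ∀ᵐ x ∂(volume.restrict (ball (0 : EuclideanSpace ℝ (Fin n)) 1)), Q x ≤ ENNReal.ofReal K)
    {r : ℝ} (hr : 0 < r) (hr1 : r < 1) {L : ℝ} (hL : 0 < L)
    (hfL : ∀ x, ‖x‖ = r → ‖f x‖ ≤ L) : r ^ (p - n) ≤ K * L ^ (p - n) := by
  have : Nonempty (Fin n) := ⟨⟨0, by omega⟩⟩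
  have hn' : (2 : ℝ) ≤ n := by exact_mod_cast hn
  have hp1 : 0 < p - 1 := by linarith
  set α := (p - n) / (p - 1) with hαdef
  have hα : 0 < α := div_pos (by linarith) hp1
  set ω := (volume : Measure (EuclideanSpace ℝ (Fin n))).toSphere univ with hω
  have hω0 : ω ≠ 0 := by
    rw [hω, Measure.measure_univ_ne_zero]
    exact Measure.toSphere_ne_zero _
  have hωt : ω ≠ ∞ := measure_ne_top _ _
  have hsub : closedBall (0 : EuclideanSpace ℝ (Fin n)) r ⊆ ball 0 1 := closedBall_subset_ball hr1
  have hc : ContinuousOn f (closedBall 0 r) :=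
    (continuousOn_iff_continuous_domRestrict.2 hf.isEmbedding.continuous).mono hsub
  have hinj : InjOn f (closedBall 0 r) :=
    (injOn_iff_injective.2 hf.isEmbedding.injective).mono hsub
  have key : ∀ r₁ ∈ Ioo 0 r, (r ^ α - r₁ ^ α) ^ (p - 1) ≤ K * L ^ (p - n) := by
    rintro r₁ ⟨hr₁, hr₁r⟩
    have hlow := le_pModulus_of_radial hn hp hL (Γ := connectingCurves (f '' sphere 0 r₁)
      (f '' sphere 0 r) (f '' ball 0 1)) fun θ hθ => by
        obtain ⟨a, b, ha, hab, haS, hbS, hG⟩ :=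
          exists_radial_segment hc hinj hf0 hr₁ hr₁r hθ
        refine ⟨a, b, hab, ha, ?_, haS, hbS, fun t ht =>
          image_mono hsub (hG t (Ioo_subset_Icc_self ht))⟩
        obtain ⟨x, hx, hxb⟩ := hbS
        have := hfL x (by simpa using hx)
        rwa [hxb, norm_smul, hθ, mul_one, Real.norm_of_nonneg (ha.trans hab).le] at this
    obtain ⟨η, hηm, hη1, hηE⟩ := exists_radial_density hn hp hr₁ hr₁r
    have hup := hf.modulus_le r₁ r hr₁ hr₁r (by
      rw [frontier_ball _ one_ne_zero]
      refine lt_of_lt_of_le ((ENNReal.ofReal_lt_one).2 hr1) (le_infEDist.2 fun y hy => ?_)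
      rw [edist_comm, edist_dist, mem_sphere.1 hy, ENNReal.ofReal_one]) η hηm.aemeasurable hη1
    have hringsub : sphericalRing (0 : EuclideanSpace ℝ (Fin n)) r₁ r ⊆ ball 0 1 :=
      fun x hx => hx.2.trans hr1
    have hQ' : ∫⁻ x in sphericalRing (0 : EuclideanSpace ℝ (Fin n)) r₁ r, Q x * η (dist x 0) ^ p ≤
        ENNReal.ofReal K * ∫⁻ x in sphericalRing (0 : EuclideanSpace ℝ (Fin n)) r₁ r,
          η ‖x‖ ^ p := by
      have hηp : Measurable fun x : EuclideanSpace ℝ (Fin n) => η ‖x‖ ^ p :=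
        (hηm.comp measurable_norm).pow_const p
      rw [← lintegral_const_mul _ hηp]
      refine lintegral_mono_ae ?_
      filter_upwards [ae_mono (Measure.restrict_mono hringsub le_rfl) hQ] with x hx
      rw [dist_zero_right]
      gcongr
    have hall := (hlow.trans hup).trans hQ'
    -- Both bounds carry the same factor `ω`, positive and finite. After it cancels, `α * (p - 1) =
    -- p - n` gives the exponent of `L`.
    rw [hηE, ← mul_assoc, ENNReal.mul_le_mul_iff_left hω0 hωt, ← ENNReal.ofReal_mul hK.le] at hall
    have hD : 0 < r ^ α - r₁ ^ α := sub_pos.2 (Real.rpow_lt_rpow hr₁.le hr₁r hα)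
    have hLα : 0 < L ^ α := Real.rpow_pos_of_pos hL _
    have h1 := (ENNReal.ofReal_le_ofReal_iff (by positivity)).1 hall
    rw [show 1 - p = -(p - 1) by ring, Real.rpow_neg (by positivity), Real.rpow_neg (by positivity),
      Real.div_rpow hLα.le hα.le, Real.div_rpow hD.le hα.le, ← Real.rpow_mul hL.le,
      show α * (p - 1) = p - n by rw [hαdef]; field_simp, inv_div, inv_div, mul_div_assoc',
      div_le_div_iff₀ (by positivity) (by positivity)] at h1
    have hαp : 0 < α ^ (p - 1) := by positivity
    refine le_of_mul_le_mul_left ?_ hαp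
    linarith
  have hlim : Tendsto (fun r₁ : ℝ => (r ^ α - r₁ ^ α) ^ (p - 1)) (𝓝[>] 0) (𝓝 (r ^ (p - n))) := by
    have hcont : Continuous fun r₁ : ℝ => (r ^ α - r₁ ^ α) ^ (p - 1) :=
      (continuous_const.sub (Real.continuous_rpow_const hα.le)).rpow_const fun _ => Or.inr hp1.le
    have h0 : (r ^ α - (0 : ℝ) ^ α) ^ (p - 1) = r ^ (p - n) := by
      rw [Real.zero_rpow hα.ne', sub_zero, ← Real.rpow_mul hr.le]
      congr 1
      rw [hαdef]
      field_simp
    rw [← h0]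
    exact (hcont.tendsto 0).mono_left nhdsWithin_le_nhds
  exact le_of_tendsto hlim (mem_of_superset (Ioo_mem_nhdsGT hr) key)

theorem corollary3 (n : ℕ) (hn : 2 ≤ n) (p : ℝ) (hp : (n : ℝ) < p)
    (Q : EuclideanSpace ℝ (Fin n) → ℝ≥0∞)
    (f : EuclideanSpace ℝ (Fin n) → EuclideanSpace ℝ (Fin n))
    (hf : IsRingQHomeomorphismAt p (Metric.ball 0 1) Q f 0) (hf0 : f 0 = 0)
    (K : ℝ) (hK : 0 < K)
    (hQ : ∀ᵐ x ∂(volume.restrict (Metric.ball (0 : EuclideanSpace ℝ (Fin n)) 1)),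
      Q x ≤ ENNReal.ofReal K) :
    ((K ^ (1 / ((n : ℝ) - p)) : ℝ) : EReal) ≤
      limsup (fun x : EuclideanSpace ℝ (Fin n) => ((‖f x‖ / ‖x‖ : ℝ) : EReal)) (𝓝[≠] 0) := by
  have : Nonempty (Fin n) := ⟨⟨0, by omega⟩⟩
  have hpn : 0 < p - n := sub_pos.2 hp
  -- It suffices to find one good point in each punctured ball: a maximum point of `‖f‖` on a small
  -- sphere.
  refine le_limsup_of_frequently_le' ?_
  rw [(Metric.nhdsWithin_basis_ball).frequently_iff]
  intro ε hε
  set r := min ε 1 / 2 with hrdef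
  have hr : 0 < r := by positivity
  have hrε : r < ε := by linarith [min_le_left ε 1, hr]
  have hr1 : r < 1 := by linarith [min_le_right ε 1, hr]
  have hc : ContinuousOn f (Metric.sphere 0 r) :=
    (continuousOn_iff_continuous_domRestrict.2 hf.isEmbedding.continuous).mono
      (Metric.sphere_subset_closedBall.trans (Metric.closedBall_subset_ball hr1))
  obtain ⟨x, hx, hmax⟩ := (isCompact_sphere (0 : EuclideanSpace ℝ (Fin n)) r).exists_isMaxOn
    (NormedSpace.sphere_nonempty.2 hr.le) hc.norm
  have hxr : ‖x‖ = r := by simpa using hx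
  have hx0 : x ≠ 0 := norm_pos_iff.1 (hxr ▸ hr)
  have hL : 0 < ‖f x‖ := by
    rw [norm_pos_iff, ← hf0]
    intro h
    exact hx0 ((injOn_iff_injective.2 hf.isEmbedding.injective) (by simpa [hxr] using hr1)
      (by simp) h)
  have key := hf.rpow_le_mul_rpow hn hp hf0 hK hQ hr hr1 hL
    fun y hy => hmax (by simpa using hy)
  refine ⟨x, ⟨by simpa [hxr] using hrε, hx0⟩, EReal.coe_le_coe_iff.2 ?_⟩
  rw [hxr, le_div_iff₀ hr]
  -- Raising to the positive power `p - n` turns `K ^ (1 / (n - p))` into `K⁻¹`.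
  refine (Real.rpow_le_rpow_iff (by positivity) hL.le hpn).1 ?_
  rw [Real.mul_rpow (by positivity) hr.le, ← Real.rpow_mul hK.le,
    show 1 / ((n : ℝ) - p) * (p - n) = -1 by
      rw [← neg_sub p, one_div_neg_eq_neg_one_div, neg_mul, one_div_mul_cancel hpn.ne'],
    Real.rpow_neg_one, inv_mul_le_iff₀ hK]
  exact key
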